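/- Let $X$ be a complex vector space, let $L(X)$ be the algebra of all linear mappings on $X$, and let $A\subseteq L(X)$ be a (not necessarily unital) subalgebra that is dense in the sense of Jacobson: for all linearly independent $\xi_1,\dots,\xi_k\in X$ and all $\eta_1,\dots,\eta_k\in X$ there is $x\in A$ with $x\xi_i=\eta_i$ for $i=1,\dots,k$. For $a,b\in L(X)$ let $M_{a,b}\colon A\to L(X)$, $M_{a,b}(x)=axb$. Let $\phi\colon A\to L(X)$ be an elementary operator of length $n$; that is, $\phi$ can be written as $\phi=\sum_{i=1}^n M_{a_i,b_i}$ with $a_i,b_i\in L(X)$, and $n\ge 0$ is the least number for which this is possible. Fix such a representation of $\phi$ with $n$ summands and put $$L(\phi)=\operatorname{span}\{a_1,\dots,a_n\},\qquad V(\phi)=\operatorname{span}\{b_ia_j : 1\le i,j\le n\}$$ (these spaces do not depend on the choice of the representation with $n$ summands). For a finite-dimensional subspace $W$ of $L(X)$ write $W\zeta=\{T\zeta : T\in W\}$ for $\zeta\in X$, and let $\operatorname{lDim} W=\max\{\dim W\zeta : \zeta\in X\}$ be its local dimension. Suppose that $\operatorname{lDim} L(\phi)=n$ and that, for every $\zeta\in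 X$ and every $x\in A$ with $xV(\phi)\zeta\subseteq\mathbb C\zeta$, the restriction of $\phi(x)$ to the (then automatically $\phi(x)$-invariant) subspace $L(\phi)\zeta$ is nilpotent. Then $\operatorname{lDim} V(\phi)\le \frac{n(n-1)}{2}$. Moreover, if $\operatorname{lDim} V(\phi)=\frac{n(n-1)}{2}$, then there are $u_1,\dots,u_n,v_1,\dots,v_n\in L(X)$ such that $\phi=\sum_{i=1}^n M_{u_i,v_i}$ and $v_iu_j=0$ for all $i\ge j$; in particular, $\dim V(\phi)=\frac{n(n-1)}{2}$. -/

import Mathlib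

namespace ElemOp

variable {X : Type*} [AddCommGroup X] [Module ℂ X]

/-- Density in the sense of Jacobson: the algebra `A` of linear mappings on `X` carries every finite
linearly independent family of vectors onto any prescribed family of vectors.
The algebra need not be unital. -/
def IsDenseAlgebra (A : NonUnitalSubalgebra ℂ (Module.End ℂ X)) : Prop :=
  ∀ (k : ℕ) (ξ η : Fin k → X), LinearIndependent ℂ ξ → ∃ x ∈ A, ∀ i, x (ξ i) = η i

/-- The two-sided multiplication `M_{a,b} : A → L(X)`, `x ↦ a x b`, for `a, b ∈ L(X)`. -/
def M (A : NonUnitalSubalgebra ℂ (Module.End ℂ X)) (a b : Module.End ℂ X) :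
    A →ₗ[ℂ] Module.End ℂ X where
  toFun x := a * (x : Module.End ℂ X) * b
  map_add' x y := by simp [mul_add, add_mul]
  map_smul' c x := by simp

/-- `φ = ∑ i, M_{a i, b i}`. -/
def IsRepresentation {A : NonUnitalSubalgebra ℂ (Module.End ℂ X)}
    (φ : A →ₗ[ℂ] Module.End ℂ X) {n : ℕ} (a b : Fin n → Module.End ℂ X) : Prop :=
  φ = ∑ i, M A (a i) (b i)

/-- `φ` is an elementary operator of length `n`: it can be written as a sum of `n` two-sided
multiplications, and `n` is the least such number. -/
def HasLength {A : NonUnitalSubalgebra ℂ (Module.End ℂ X)}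
    (φ : A →ₗ[ℂ] Module.End ℂ X) (n : ℕ) : Prop :=
  IsLeast {m : ℕ | ∃ a b : Fin m → Module.End ℂ X, IsRepresentation φ a b} n

/-- `L(φ) = span {a_1, …, a_n}`, for `φ = ∑ M_{a_i,b_i}`. -/
def spaceL {n : ℕ} (a : Fin n → Module.End ℂ X) : Submodule ℂ (Module.End ℂ X) :=
  Submodule.span ℂ (Set.range a)

/-- `V(φ) = span {b_i a_j : 1 ≤ i, j ≤ n}`, for `φ = ∑ M_{a_i,b_i}`. -/
def spaceV {n : ℕ} (a b : Fin n → Module.End ℂ X) : Submodule ℂ (Module.End ℂ X) :=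
  Submodule.span ℂ (Set.range fun p : Fin n × Fin n => b p.1 * a p.2)

/-- `V ζ = {T ζ : T ∈ V}`, a subspace of `X`. -/
def orbit (V : Submodule ℂ (Module.End ℂ X)) (ζ : X) : Submodule ℂ X :=
  V.map (LinearMap.applyₗ ζ)

/-- The local dimension `max {dim V ζ : ζ ∈ X}` of a finite-dimensional subspace `V` of `L(X)`. -/
noncomputable def lDim (V : Submodule ℂ (Module.End ℂ X)) : ℕ :=
  sSup (Set.range fun ζ : X => Module.finrank ℂ (orbit V ζ))

/-- The subspace `W` is invariant under `y`, and the restriction of `y` to `W` is nilpotent. -/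
def NilpotentOn (y : Module.End ℂ X) (W : Submodule ℂ X) : Prop :=
  ∃ h : ∀ η ∈ W, y η ∈ W, IsNilpotent (y.restrict h)

/-- For all `ζ ∈ X` and `x ∈ A` such that `x V(φ) ζ ⊆ ℂ ζ`, the restriction of `φ(x)` to
`L(φ) ζ` is nilpotent; here `φ = ∑ M_{a_i,b_i}`. The invariance of `L(φ) ζ` under `φ(x)`, which
`NilpotentOn` includes, always holds for such `ζ` and `x`: see `invariant_orbit` below. -/
def LocallyNilpotentCond {A : NonUnitalSubalgebra ℂ (Module.End ℂ X)}
    (φ : A →ₗ[ℂ] Module.End ℂ X) {n : ℕ} (a b : Fin n → Module.End ℂ X) : Prop :=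
  ∀ (ζ : X) (x : A),
    (orbit (spaceV a b) ζ).map (x : Module.End ℂ X) ≤ Submodule.span ℂ {ζ} →
      NilpotentOn (φ x) (orbit (spaceL a) ζ)

theorem invariant_orbit {A : NonUnitalSubalgebra ℂ (Module.End ℂ X)}
    {φ : A →ₗ[ℂ] Module.End ℂ X} {n : ℕ} {a b : Fin n → Module.End ℂ X}
    (hφ : IsRepresentation φ a b) {ζ : X} {x : A}
    (hx : (orbit (spaceV a b) ζ).map (x : Module.End ℂ X) ≤ Submodule.span ℂ {ζ}) :
    ∀ η ∈ orbit (spaceL a) ζ, φ x η ∈ orbit (spaceL a) ζ := by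
  have key : ∀ T ∈ spaceL a, φ x (T ζ) ∈ orbit (spaceL a) ζ := by
    intro T hT
    induction hT using Submodule.span_induction with
    | mem T hT =>
      obtain ⟨j, rfl⟩ := hT
      have : φ x (a j ζ) = ∑ i, a i ((x : Module.End ℂ X) (b i (a j ζ))) := by
        rw [hφ]
        simp [M, LinearMap.sum_apply]
      rw [this]
      refine Submodule.sum_mem _ fun i _ => ?_
      have h1 : (x : Module.End ℂ X) (b i (a j ζ)) ∈ Submodule.span ℂ {ζ} :=
        hx ⟨_, ⟨b i * a j, Submodule.subset_span ⟨(i, j), rfl⟩, rfl⟩, rfl⟩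
      obtain ⟨c, hc⟩ := Submodule.mem_span_singleton.1 h1
      rw [← hc, map_smul]
      exact Submodule.smul_mem _ _ ⟨a i, Submodule.subset_span ⟨i, rfl⟩, rfl⟩
    | zero => simp
    | add S T _ _ hS hT => simpa using Submodule.add_mem _ hS hT
    | smul c T _ hT => simpa using Submodule.smul_mem _ c hT
  rintro _ ⟨T, hT, rfl⟩
  exact key T hT

end ElemOp

/-!
For a vector `ζ` and a functional `f` on `X` consider the matrix `N(f, ζ) = (f (b_i a_j ζ))`. If
`a_1 ζ, …, a_n ζ` are independent, density provides `x ∈ A` acting on `V(φ) ζ` as `f ⊗ ζ`, and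
`N(f, ζ)` is the matrix of `φ x` on `L(φ) ζ`; so the hypothesis makes it nilpotent
(`isNilpotent_localMatrix`). The matrices `N(f, ζ)`, for fixed `ζ`, form a linear space of dimension
`dim V(φ) ζ`, and the bound on the local dimension is Gerstenhaber's theorem on linear spaces of
nilpotent matrices, applied at a `ζ` where both local dimensions are attained.

Gerstenhaber's theorem is proved in characteristic zero from the orthogonality relations
`tr (u w) = 0` and `tr (u² w) = 0`, by passing to the quotient by a line
(`IsNilSpace.finrank_le_choose`). In the case of equality the space contains all rank-one maps that
the dimension count allows, which makes it closed under squaring (`IsNilSpace.mul_self_mem`).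
A nilpotent space closed under squaring, and so under the Jordan product, has a common kernel vector
by an argument in the manner of Engel's theorem (`IsNilSpace.exists_common_kernel`), and hence it is
strictly triangularizable.

If `dim V(φ) ζ = n (n - 1) / 2` for generic `ζ`, then each of these spaces is conjugate to the space
of all strictly upper triangular matrices, by a conjugation that a priori depends on `ζ`. Fix a
generic `ζ` and change the representation such that all `N(f, ζ)` are strictly upper triangular.
For any `η` and all but finitely many `t` the space of the matrices `N(f, ζ) + t N(f, η)` is
again conjugate to that space, so it is closed under products. To first order in `t` this says that
`N(f, ζ) ↦ N(f, η)` is a derivation modulo strictly upper triangular matrices, and together with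
nilpotency that forces all `N(f, η)` to be strictly upper triangular
(`mem_strictUpper_of_pencil`). So `v_i u_j = 0` for `j ≤ i`, since `f` and `η` are arbitrary.
-/

namespace ElemOp

/-! ### Linear spaces of nilpotent endomorphisms -/

section NilSpace

variable {K E F : Type*} [Field K] [AddCommGroup E] [Module K E] [AddCommGroup F] [Module K F]

/-- A linear space of endomorphisms all of whose members are nilpotent. -/
def IsNilSpace (V : Submodule K (Module.End K E)) : Prop := ∀ u ∈ V, IsNilpotent u

theorem IsNilSpace.trace_mul_eq_zero [CharZero K] {V : Submodule K (Module.End K E)}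
    (hV : IsNilSpace V) {u w : Module.End K E} (hu : u ∈ V) (hw : w ∈ V) :
    LinearMap.trace K E (u * w) = 0 := by
  have tr0 : ∀ v ∈ V, LinearMap.trace K E (v * v) = 0 := fun v hv =>
    (LinearMap.isNilpotent_trace_of_isNilpotent
      ((Commute.refl v).isNilpotent_mul_right (hV v hv))).eq_zero
  have h := tr0 (u + w) (V.add_mem hu hw)
  have e : (u + w) * (u + w) = u * u + u * w + (w * u + w * w) := by noncomm_ring
  rw [e, map_add, map_add, map_add, tr0 u hu, tr0 w hw, LinearMap.trace_mul_comm K w u] at h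
  have h2 : (2 : K) * LinearMap.trace K E (u * w) = 0 := by linear_combination h
  simpa using h2

theorem IsNilSpace.trace_sq_mul_eq_zero [CharZero K] {V : Submodule K (Module.End K E)}
    (hV : IsNilSpace V) {u w : Module.End K E} (hu : u ∈ V) (hw : w ∈ V) :
    LinearMap.trace K E (u * u * w) = 0 := by
  have tr0 : ∀ v ∈ V, LinearMap.trace K E (v * v * v) = 0 := fun v hv => by
    refine (LinearMap.isNilpotent_trace_of_isNilpotent ?_).eq_zero
    rw [mul_assoc]
    exact ((Commute.refl v).mul_right (Commute.refl v)).isNilpotent_mul_right (hV v hv)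
  have e : ∀ x y : Module.End K E, LinearMap.trace K E ((x + y) * (x + y) * (x + y)) =
      LinearMap.trace K E (x * x * x) + 3 * LinearMap.trace K E (x * x * y)
        + 3 * LinearMap.trace K E (y * y * x) + LinearMap.trace K E (y * y * y) := by
    intro x y
    have : (x + y) * (x + y) * (x + y) = x * x * x + x * x * y + x * y * x + x * (y * y)
      + y * (x * x) + y * x * y + y * y * x + y * y * y := by noncomm_ring
    rw [this]
    simp only [map_add]
    rw [LinearMap.trace_mul_comm K (x * y) x, LinearMap.trace_mul_comm K (y * x) y,
      LinearMap.trace_mul_comm K y (x * x), LinearMap.trace_mul_comm K x (y * y), ← mul_assoc,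
      ← mul_assoc]
    ring
  have h1 := e u w
  have h2 := e u (-w)
  rw [tr0 _ (V.add_mem hu hw), tr0 _ hu, tr0 _ hw] at h1
  rw [tr0 _ (V.add_mem hu (V.neg_mem hw)), tr0 _ hu, tr0 _ (V.neg_mem hw)] at h2
  simp only [neg_mul, mul_neg, neg_neg, map_neg] at h2
  have h3 : (6 : K) * LinearMap.trace K E (u * u * w) = 0 := by linear_combination h2 - h1
  simpa using h3

/-- The linear map `u ↦ π u s` from endomorphisms of `E` to endomorphisms of `F`. With `s` a
section of a quotient map `π`, or `π` a retraction of an inclusion `s`, it computes the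
endomorphism induced by `u` on a quotient, or the restriction of `u` to a subspace. -/
def compress (π : E →ₗ[K] F) (s : F →ₗ[K] E) : Module.End K E →ₗ[K] Module.End K F where
  toFun u := π ∘ₗ u ∘ₗ s
  map_add' u v := by ext; simp
  map_smul' c u := by ext; simp

@[simp] theorem compress_apply (π : E →ₗ[K] F) (s : F →ₗ[K] E) (u : Module.End K E) (x : F) :
    compress π s u x = π (u (s x)) := rfl

theorem isNilpotent_compress_of_quotient {π : E →ₗ[K] F} {s : F →ₗ[K] E}
    (hs : ∀ x, π (s x) = x) {u : Module.End K E} (hu : IsNilpotent u)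
    (hint : ∀ x, π (u (s (π x))) = π (u x)) : IsNilpotent (compress π s u) := by
  obtain ⟨m, hm⟩ := hu
  have h : ∀ k x, ((compress π s u) ^ k) (π x) = π ((u ^ k) x) := by
    intro k
    induction k with
    | zero => simp
    | succ k ih => intro x; rw [pow_succ, pow_succ, Module.End.mul_apply, compress_apply, hint, ih,
        Module.End.mul_apply]
  refine ⟨m, LinearMap.ext fun x => ?_⟩
  rw [← hs x, h, hm]; simp

theorem isNilpotent_compress_of_sub {p : E →ₗ[K] F} {ι : F →ₗ[K] E}
    (hι : Function.Injective ι) {u : Module.End K E} (hu : IsNilpotent u)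
    (hint : ∀ x, ι (p (u (ι x))) = u (ι x)) : IsNilpotent (compress p ι u) := by
  obtain ⟨m, hm⟩ := hu
  have h : ∀ k x, ι (((compress p ι u) ^ k) x) = (u ^ k) (ι x) := by
    intro k
    induction k with
    | zero => simp
    | succ k ih => intro x; rw [pow_succ, pow_succ, Module.End.mul_apply, ih, compress_apply, hint,
        Module.End.mul_apply]
  refine ⟨m, LinearMap.ext fun x => hι ?_⟩
  rw [h, hm]; simp

/-- The subspace `{u ∈ V : u x = 0}`. -/
def killing (V : Submodule K (Module.End K E)) (x : E) : Submodule K (Module.End K E) :=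
  V ⊓ LinearMap.ker (LinearMap.applyₗ x)

/-- The subspace `V x = {u x : u ∈ V}`. -/
def image (V : Submodule K (Module.End K E)) (x : E) : Submodule K E :=
  V.map (LinearMap.applyₗ x)

theorem finrank_map_add_finrank_inf_ker [FiniteDimensional K E] (f : E →ₗ[K] F)
    (V : Submodule K E) :
    Module.finrank K (V.map f) + Module.finrank K (V ⊓ LinearMap.ker f : Submodule K E)
      = Module.finrank K V := by
  have h := LinearMap.finrank_range_add_finrank_ker (f.domRestrict V)
  rw [LinearMap.range_domRestrict] at h
  rw [← h]
  congr 1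
  have e : (LinearMap.ker (f.domRestrict V)).map V.subtype = V ⊓ LinearMap.ker f := by
    ext x; constructor
    · rintro ⟨⟨y, hy⟩, hz, rfl⟩; exact ⟨hy, hz⟩
    · rintro ⟨hy, hz⟩; exact ⟨⟨x, hy⟩, hz, rfl⟩
  rw [← e]
  exact (Submodule.finrank_map_subtype_eq V (LinearMap.ker (f.domRestrict V)))

theorem finrank_image_add_finrank_killing [FiniteDimensional K E]
    (V : Submodule K (Module.End K E)) (x : E) :
    Module.finrank K (image V x) + Module.finrank K (killing V x) = Module.finrank K V :=
  finrank_map_add_finrank_inf_ker _ _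

theorem IsNilSpace.notMem_image {V : Submodule K (Module.End K E)}
    (hV : IsNilSpace V) {x : E} (hx : x ≠ 0) : x ∉ image V x := by
  rintro ⟨u, hu, h⟩
  obtain ⟨m, hm⟩ := hV u hu
  have : ∀ k, (u ^ k) x = x := by
    intro k
    induction k with
    | zero => simp
    | succ k ih => rw [pow_succ, Module.End.mul_apply]; change (u ^ k) (u x) = x
                   rw [show u x = x from h, ih]
  apply hx
  rw [← this m, hm]; rfl

/-- The annihilator in the dual of `V x + K x`. -/
def imageAnn (V : Submodule K (Module.End K E)) (x : E) : Submodule K (Module.Dual K E) :=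
  (image V x ⊔ Submodule.span K {x}).dualAnnihilator

theorem mem_imageAnn {V : Submodule K (Module.End K E)} {x : E} {φ : Module.Dual K E} :
    φ ∈ imageAnn V x ↔ (∀ w ∈ V, φ (w x) = 0) ∧ φ x = 0 := by
  simp only [imageAnn, Submodule.dualAnnihilator_sup_eq, Submodule.mem_inf,
    Submodule.mem_dualAnnihilator, Submodule.mem_span_singleton]
  constructor
  · rintro ⟨h1, h2⟩
    exact ⟨fun w hw => h1 _ ⟨w, hw, rfl⟩, h2 x ⟨1, one_smul _ _⟩⟩
  · rintro ⟨h1, h2⟩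
    refine ⟨?_, ?_⟩
    · rintro _ ⟨w, hw, rfl⟩; exact h1 w hw
    · rintro _ ⟨c, rfl⟩; simp [h2]

theorem IsNilSpace.finrank_imageAnn [FiniteDimensional K E] {V : Submodule K (Module.End K E)}
    (hV : IsNilSpace V) {x : E} (hx : x ≠ 0) :
    Module.finrank K (image V x) + Module.finrank K (imageAnn V x) + 1 = Module.finrank K E := by
  have h1 := Subspace.finrank_add_finrank_dualAnnihilator_eq (image V x ⊔ Submodule.span K {x})
  have h2 := Submodule.finrank_sup_add_finrank_inf_eq (image V x) (Submodule.span K {x})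
  have h3 : image V x ⊓ Submodule.span K {x} = ⊥ :=
    disjoint_iff.1 ((Submodule.disjoint_span_singleton' hx).2 (hV.notMem_image hx))
  rw [h3, finrank_bot, finrank_span_singleton hx] at h2
  unfold imageAnn
  omega

/-- An endomorphism with range in `K x` that kills `x` and is orthogonal to `V` for the trace form
is `φ ⊗ x` for a functional `φ` that annihilates both `x` and `V x`: the trace of `(φ ⊗ x) w` is
`φ (w x)`. -/
theorem exists_eq_smulRight [FiniteDimensional K E]
    {V : Submodule K (Module.End K E)} {x : E} (hx : x ≠ 0)
    {u : Module.End K E} (hux : u x = 0) (hr : ∀ e, u e ∈ Submodule.span K {x})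
    (htr : ∀ w ∈ V, LinearMap.trace K E (u * w) = 0) :
    ∃ φ ∈ imageAnn V x, u = LinearMap.smulRight φ x := by
  obtain ⟨ξ, hξ⟩ : ∃ ξ : Module.Dual K E, ξ x = 1 := by
    obtain ⟨g, hg⟩ := (LinearMap.toSpanSingleton K E x).exists_leftInverse_of_injective
      (LinearMap.ker_toSpanSingleton K hx)
    exact ⟨g, by simpa using LinearMap.congr_fun hg 1⟩
  have hu : u = LinearMap.smulRight (ξ ∘ₗ u) x := by
    ext e
    obtain ⟨c, hc⟩ := Submodule.mem_span_singleton.1 (hr e)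
    simp [← hc, hξ]
  refine ⟨ξ ∘ₗ u, mem_imageAnn.2 ⟨fun w hw => ?_, by simp [hux]⟩, hu⟩
  have := htr w hw
  rw [hu] at this
  have e : LinearMap.smulRight (ξ ∘ₗ u) x * w = LinearMap.smulRight ((ξ ∘ₗ u) ∘ₗ w) x := by
    ext; simp
  rw [e, LinearMap.trace_smulRight] at this
  simpa using this

end NilSpace

/-! ### Gerstenhaber's bound and the case of equality -/

section Gerstenhaber

variable {K E : Type*} [Field K] [AddCommGroup E] [Module K E]

/-- The linear map `φ ↦ φ ⊗ x`, where `φ ⊗ x` is the endomorphism `e ↦ φ e • x`. -/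
def rankOne (x : E) : Module.Dual K E →ₗ[K] Module.End K E := LinearMap.smulRightₗ.flip x

theorem exists_section_mkQ (P : Submodule K E) : ∃ s : (E ⧸ P) →ₗ[K] E, ∀ y, P.mkQ (s y) = y := by
  obtain ⟨s, hs⟩ := P.mkQ.exists_rightInverse_of_surjective P.range_mkQ
  exact ⟨s, fun y => LinearMap.congr_fun hs y⟩

theorem section_mkQ_sub_mem {P : Submodule K E} {s : (E ⧸ P) →ₗ[K] E} (hs : ∀ y, P.mkQ (s y) = y)
    (e : E) : s (P.mkQ e) - e ∈ P := by
  refine (Submodule.Quotient.mk_eq_zero P).1 ?_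
  change P.mkQ (s (P.mkQ e) - e) = 0
  rw [map_sub, hs, sub_self]

theorem section_mkQ_span_singleton {x : E} {s : (E ⧸ Submodule.span K {x}) →ₗ[K] E}
    (hs : ∀ y, (Submodule.span K {x}).mkQ (s y) = y) {u : Module.End K E} (hu : u x = 0) (e : E) :
    u (s ((Submodule.span K {x}).mkQ e)) = u e := by
  obtain ⟨c, hc⟩ := Submodule.mem_span_singleton.1 (section_mkQ_sub_mem hs e)
  rw [← sub_eq_zero, ← map_sub, ← hc, map_smul, hu, smul_zero]

/-- The space of endomorphisms of `E / K x` induced by the members of `V` that kill `x`. -/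
def inducedQuot (V : Submodule K (Module.End K E)) (x : E)
    (s : (E ⧸ Submodule.span K {x}) →ₗ[K] E) :
    Submodule K (Module.End K (E ⧸ Submodule.span K {x})) :=
  (killing V x).map (compress (Submodule.span K {x}).mkQ s)

theorem IsNilSpace.isNilSpace_inducedQuot {V : Submodule K (Module.End K E)} (hV : IsNilSpace V) {x : E}
    {s : (E ⧸ Submodule.span K {x}) →ₗ[K] E}
    (hs : ∀ y, (Submodule.span K {x}).mkQ (s y) = y) : IsNilSpace (inducedQuot V x s) := by
  rintro _ ⟨u, ⟨hu, hux⟩, rfl⟩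
  exact isNilpotent_compress_of_quotient hs (hV u hu)
    fun e => by rw [section_mkQ_span_singleton hs hux]

theorem finrank_quotient_span_singleton_add_one [FiniteDimensional K E] {x : E} (hx : x ≠ 0) :
    Module.finrank K (E ⧸ Submodule.span K {x}) + 1 = Module.finrank K E := by
  rw [← Submodule.finrank_quotient_add_finrank (Submodule.span K {x}), finrank_span_singleton hx]

variable [FiniteDimensional K E] [CharZero K]

theorem IsNilSpace.killing_inf_ker_le {V : Submodule K (Module.End K E)} (hV : IsNilSpace V)
    {x : E} (hx : x ≠ 0) {s : (E ⧸ Submodule.span K {x}) →ₗ[K] E}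
    (hs : ∀ y, (Submodule.span K {x}).mkQ (s y) = y) :
    killing V x ⊓ LinearMap.ker (compress (Submodule.span K {x}).mkQ s) ≤
      (imageAnn V x).map (rankOne x) := by
  rintro u ⟨⟨hu, hux⟩, hk⟩
  obtain ⟨φ, hφ, h⟩ := exists_eq_smulRight hx hux (fun e => by
    have := LinearMap.congr_fun hk ((Submodule.span K {x}).mkQ e)
    rw [compress_apply, section_mkQ_span_singleton hs hux] at this
    rwa [← Submodule.ker_mkQ (Submodule.span K {x})]) (fun w hw => hV.trace_mul_eq_zero hu hw)
  exact ⟨φ, hφ, h.symm⟩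

/-- The dimension count behind Gerstenhaber's theorem: the members of `V` that kill `x` and induce
zero on `E / K x` have the form `φ ⊗ x` with `φ` annihilating `V x + K x`, so the larger `V x` is,
the fewer they are. -/
theorem IsNilSpace.finrank_le_of_ne_zero {V : Submodule K (Module.End K E)} (hV : IsNilSpace V)
    {x : E} (hx : x ≠ 0) {s : (E ⧸ Submodule.span K {x}) →ₗ[K] E}
    (hs : ∀ y, (Submodule.span K {x}).mkQ (s y) = y) :
    Module.finrank K V ≤ Module.finrank K (E ⧸ Submodule.span K {x}) +
      Module.finrank K (inducedQuot V x s) := by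
  have h1 := finrank_image_add_finrank_killing V x
  have h2 := finrank_map_add_finrank_inf_ker (compress (Submodule.span K {x}).mkQ s) (killing V x)
  have h3 := (Submodule.finrank_mono (hV.killing_inf_ker_le hx hs)).trans
    (Submodule.finrank_map_le _ _)
  have h4 := hV.finrank_imageAnn hx
  have h5 := finrank_quotient_span_singleton_add_one (K := K) hx
  unfold inducedQuot
  omega

/-- If the dimension count is sharp, then all the rank-one maps that it admits belong to `V`. -/
theorem IsNilSpace.smulRight_mem {V : Submodule K (Module.End K E)} (hV : IsNilSpace V)
    {x : E} (hx : x ≠ 0) {s : (E ⧸ Submodule.span K {x}) →ₗ[K] E}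
    (hs : ∀ y, (Submodule.span K {x}).mkQ (s y) = y)
    (hdim : Module.finrank K (E ⧸ Submodule.span K {x}) +
      Module.finrank K (inducedQuot V x s) ≤ Module.finrank K V)
    {φ : Module.Dual K E} (hφ : φ ∈ imageAnn V x) : LinearMap.smulRight φ x ∈ V := by
  have h1 := finrank_image_add_finrank_killing V x
  have h2 := finrank_map_add_finrank_inf_ker (compress (Submodule.span K {x}).mkQ s) (killing V x)
  have h3 := Submodule.finrank_map_le (rankOne x) (imageAnn V x)
  have h4 := hV.finrank_imageAnn hx
  have h5 := finrank_quotient_span_singleton_add_one (K := K) hx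
  unfold inducedQuot at hdim
  have h6 := Submodule.eq_of_le_of_finrank_le (hV.killing_inf_ker_le hx hs) (by omega)
  have h7 : LinearMap.smulRight φ x ∈ (imageAnn V x).map (rankOne x) := ⟨φ, hφ, rfl⟩
  rw [← h6] at h7
  exact h7.1.1

/-- Gerstenhaber's bound for the dimension of a linear space of nilpotent endomorphisms. -/
theorem IsNilSpace.finrank_le_choose {n : ℕ} (hn : Module.finrank K E = n)
    {V : Submodule K (Module.End K E)} (hV : IsNilSpace V) :
    Module.finrank K V ≤ n.choose 2 := by
  induction n generalizing E with
  | zero =>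
    have := Submodule.finrank_le V
    rw [Module.finrank_linearMap, hn] at this
    simpa using this
  | succ n ih =>
    have : Nontrivial E := Module.nontrivial_of_finrank_pos (R := K) (by omega)
    obtain ⟨x, hx⟩ := exists_ne (0 : E)
    obtain ⟨s, hs⟩ := exists_section_mkQ (Submodule.span K {x})
    have h1 := hV.finrank_le_of_ne_zero hx hs
    have h2 := finrank_quotient_span_singleton_add_one (K := K) hx
    have h3 := ih (by omega) (hV.isNilSpace_inducedQuot hs)
    have h4 : (n + 1).choose 2 = n + n.choose 2 := by
      rw [Nat.choose_succ_succ', Nat.choose_one_right]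
    omega

/-- A nilpotent space of maximal dimension is closed under squaring: by induction `u²` agrees, on
the quotient by a line `K x` killed by `u`, with some `v ∈ V`, and `u² - v` is orthogonal to `V`
for the trace form, so it is one of the rank-one members that maximality provides. -/
theorem IsNilSpace.mul_self_mem {n : ℕ} (hn : Module.finrank K E = n)
    {V : Submodule K (Module.End K E)} (hV : IsNilSpace V)
    (hdim : Module.finrank K V = n.choose 2) {u : Module.End K E} (hu : u ∈ V) : u * u ∈ V := by
  induction n generalizing E with
  | zero =>
    have : Subsingleton E := Module.finrank_zero_iff.1 hn
    have : u * u = 0 := LinearMap.ext fun x => Subsingleton.elim _ _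
    rw [this]; exact V.zero_mem
  | succ n ih =>
    have : Nontrivial E := Module.nontrivial_of_finrank_pos (R := K) (by omega)
    obtain ⟨x, hx, hux⟩ : ∃ x : E, x ≠ 0 ∧ u x = 0 := by
      by_contra! h
      have hinj : Function.Injective u := by
        rw [injective_iff_map_eq_zero]
        intro a ha
        by_contra h0
        exact h a h0 ha
      obtain ⟨m, hm⟩ := hV u hu
      obtain ⟨y, hy⟩ := exists_ne (0 : E)
      have : Function.Injective (u ^ m) := by
        rw [Module.End.coe_pow]; exact hinj.iterate m
      exact hy (this (by rw [hm]; simp))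
    obtain ⟨s, hs⟩ := exists_section_mkQ (Submodule.span K {x})
    have h1 := hV.finrank_le_of_ne_zero hx hs
    have h2 := finrank_quotient_span_singleton_add_one (K := K) hx
    have hnil := hV.isNilSpace_inducedQuot hs
    have h3 := hnil.finrank_le_choose (n := n) (by omega)
    have hch : (n + 1).choose 2 = n + n.choose 2 := by
      rw [Nat.choose_succ_succ', Nat.choose_one_right]
    have h4 := ih (E := E ⧸ Submodule.span K {x}) (by omega) hnil (by omega)
      (u := compress (Submodule.span K {x}).mkQ s u) ⟨u, ⟨hu, hux⟩, rfl⟩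
    obtain ⟨v, ⟨hv, hvx⟩, hvu⟩ := h4
    have hvx' : v x = 0 := hvx
    have key : ∀ e, (u * u - v) e ∈ Submodule.span K {x} := by
      intro e
      have := LinearMap.congr_fun hvu ((Submodule.span K {x}).mkQ e)
      simp only [Module.End.mul_apply, compress_apply,
        section_mkQ_span_singleton hs hux, section_mkQ_span_singleton hs hvx] at this
      rw [← Submodule.ker_mkQ (Submodule.span K {x}), LinearMap.mem_ker]
      simp only [LinearMap.sub_apply, Module.End.mul_apply, map_sub]
      rw [this, sub_self]
    obtain ⟨φ, hφ, h⟩ := exists_eq_smulRight (V := V) hx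
      (by simp [hux, hvx']) key (fun w hw => by
        rw [sub_mul, map_sub, hV.trace_sq_mul_eq_zero hu hw, hV.trace_mul_eq_zero hv hw, sub_zero])
    have h5 := hV.smulRight_mem hx hs (by omega) hφ
    rw [← h] at h5
    simpa using V.add_mem h5 hv

end Gerstenhaber

/-! ### Triangularization of nilpotent spaces closed under squaring -/

section Triangularization

variable {K E : Type*} [Field K] [AddCommGroup E] [Module K E]

theorem mul_add_mul_mem {V : Submodule K (Module.End K E)} (hsq : ∀ u ∈ V, u * u ∈ V)
    {u v : Module.End K E} (hu : u ∈ V) (hv : v ∈ V) : u * v + v * u ∈ V := by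
  have e : u * v + v * u = (u + v) * (u + v) - u * u - v * v := by noncomm_ring
  rw [e]
  exact V.sub_mem (V.sub_mem (hsq _ (V.add_mem hu hv)) (hsq _ hu)) (hsq _ hv)

/-- An analogue of Engel's theorem: a nilpotent space closed under squaring, hence under the Jordan
product `u v + v u`, has a common kernel vector. If `x` is a vector killed by as many members of
`V` as possible, but not by all of them, then these members act on the nonzero space `V x`, and by
induction they kill some `y = v x ≠ 0` in it; they also kill every `v ^ j y`, and the last nonzero
one of these vectors is killed by `v` as well, against the choice of `x`. -/
theorem IsNilSpace.exists_common_kernel [FiniteDimensional K E] [Nontrivial E]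
    {V : Submodule K (Module.End K E)} (hV : IsNilSpace V) (hsq : ∀ u ∈ V, u * u ∈ V) :
    ∃ z : E, z ≠ 0 ∧ ∀ u ∈ V, u z = 0 := by
  induction hd : Module.finrank K V using Nat.strong_induction_on generalizing E with
  | _ d ih =>
  -- `x` is chosen such that the subspace of `V` killing it is as large as possible.
  obtain ⟨x, hx, hmax⟩ : ∃ x : E, x ≠ 0 ∧ ∀ y : E, y ≠ 0 →
      Module.finrank K (image V x) ≤ Module.finrank K (image V y) := by
    classical
    have hex : ∃ m, ∃ x : E, x ≠ 0 ∧ Module.finrank K (image V x) = m := by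
      obtain ⟨x, hx⟩ := exists_ne (0 : E)
      exact ⟨_, x, hx, rfl⟩
    obtain ⟨x, hx, h⟩ := Nat.find_spec hex
    exact ⟨x, hx, fun y hy => h ▸ Nat.find_min' hex ⟨y, hy, rfl⟩⟩
  by_contra! hno
  obtain ⟨v₀, hv₀, hv₀x⟩ := hno x hx
  -- `V x` is invariant under the members of `V` that kill `x`.
  have hinv : ∀ u ∈ killing V x, ∀ y ∈ image V x, u y ∈ image V x := by
    rintro u ⟨hu, hux⟩ _ ⟨v, hv, rfl⟩
    have hux' : u x = 0 := hux
    exact ⟨u * v + v * u, mul_add_mul_mem hsq hu hv, by simp [hux']⟩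
  obtain ⟨p, hp⟩ := (image V x).subtype.exists_leftInverse_of_injective (by simp)
  have hp' : ∀ y : E, y ∈ image V x → (p y : E) = y := fun y hy =>
    congrArg Subtype.val (LinearMap.congr_fun hp ⟨y, hy⟩)
  have : Nontrivial (image V x) := ⟨⟨⟨v₀ x, v₀, hv₀, rfl⟩, 0, fun h => hv₀x (congrArg Subtype.val h)⟩⟩
  have hdim := finrank_image_add_finrank_killing V x
  have hpos : 0 < Module.finrank K (image V x) := Module.finrank_pos
  have hle := Submodule.finrank_map_le (compress p (image V x).subtype) (killing V x)
  obtain ⟨⟨y, hy⟩, hy0, hkill⟩ := ih _ (by omega)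
    (V := (killing V x).map (compress p (image V x).subtype))
    (by
      rintro _ ⟨u, hu, rfl⟩
      exact isNilpotent_compress_of_sub Subtype.val_injective (hV u hu.1)
        fun z => hp' _ (hinv u hu z z.2))
    (by
      rintro _ ⟨u, hu, rfl⟩
      refine ⟨u * u, ⟨hsq u hu.1, ?_⟩, ?_⟩
      · have hux : u x = 0 := hu.2
        change u (u x) = 0
        rw [hux, map_zero]
      · ext z
        simp only [compress_apply, Module.End.mul_apply, Submodule.subtype_apply]
        rw [hp' _ (hinv u hu z z.2)]) rfl
  have hy0' : y ≠ 0 := fun h => hy0 (Subtype.ext h)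
  have hkill' : ∀ u ∈ killing V x, u y = 0 := by
    intro u hu
    have h := congrArg Subtype.val (hkill _ ⟨u, hu, rfl⟩)
    simp only [compress_apply, Submodule.subtype_apply] at h
    rwa [hp' _ (hinv u hu y hy)] at h
  obtain ⟨v, hv, hvx⟩ := hy
  have hvx' : v x = y := hvx
  -- Every member of `V` that kills `x` kills all `v ^ j y`.
  have hall : ∀ j, ∀ u ∈ killing V x, u ((v ^ j) y) = 0 := by
    intro j
    induction j with
    | zero => intro u hu; simpa using hkill' u hu
    | succ j ihj =>
      intro u hu
      have hux : u x = 0 := hu.2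
      have hm : u * v + v * u ∈ killing V x :=
        ⟨mul_add_mul_mem hsq hu.1 hv, by
          change u (v x) + v (u x) = 0
          rw [hux, hvx', hkill' u hu, map_zero, add_zero]⟩
      have h := ihj _ hm
      simp only [LinearMap.add_apply, Module.End.mul_apply] at h
      rw [ihj u hu, map_zero, add_zero] at h
      rwa [pow_succ', Module.End.mul_apply]
  obtain ⟨m, hm⟩ := hV v hv
  classical
  have hex : ∃ j, (v ^ j) y = 0 := ⟨m, by rw [hm]; rfl⟩
  obtain ⟨j, hj⟩ : ∃ j, Nat.find hex = j + 1 :=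
    Nat.exists_eq_succ_of_ne_zero fun h => hy0' (by simpa [h] using Nat.find_spec hex)
  have hz0 : (v ^ j) y ≠ 0 := Nat.find_min hex (by omega)
  have hvz : v ((v ^ j) y) = 0 := by
    have := Nat.find_spec hex
    rwa [hj, pow_succ', Module.End.mul_apply] at this
  have hlt : killing V x < killing V ((v ^ j) y) := by
    refine lt_of_le_of_ne (fun u hu => ⟨hu.1, hall j u hu⟩) fun h => ?_
    have : v ∈ killing V x := h ▸ ⟨hv, hvz⟩
    exact hy0' (hvx'.symm.trans this.2)
  have h1 := Submodule.finrank_lt_finrank_of_lt hlt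
  have h2 := finrank_image_add_finrank_killing V ((v ^ j) y)
  have h3 := hmax _ hz0
  omega

/-- Simultaneous strict triangularization: the first `k` vectors of a basis in which every member
of `V` is strictly upper triangular. -/
theorem IsNilSpace.exists_flag [FiniteDimensional K E]
    {V : Submodule K (Module.End K E)} (hV : IsNilSpace V) (hsq : ∀ u ∈ V, u * u ∈ V)
    (k : ℕ) (hk : k ≤ Module.finrank K E) :
    ∃ e : Fin k → E, LinearIndependent K e ∧
      ∀ u ∈ V, ∀ j, u (e j) ∈ Submodule.span K (e '' {i | i < j}) := by
  induction k with
  | zero => exact ⟨Fin.elim0, linearIndependent_empty_type, fun _ _ j => j.elim0⟩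
  | succ k ih =>
    obtain ⟨e, he, hflag⟩ := ih (by omega)
    set P := Submodule.span K (Set.range e) with hP
    have hPinv : ∀ u ∈ V, ∀ y ∈ P, u y ∈ P := by
      intro u hu y hy
      have : P ≤ P.comap u := by
        rw [hP, Submodule.span_le]
        rintro _ ⟨j, rfl⟩
        exact Submodule.span_mono (Set.image_subset_range _ _) (hflag u hu j)
      exact this hy
    obtain ⟨s, hs⟩ := exists_section_mkQ P
    have hint : ∀ u ∈ V, ∀ y, P.mkQ (u (s (P.mkQ y))) = P.mkQ (u y) := by
      intro u hu y
      rw [← sub_eq_zero, ← map_sub, ← map_sub]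
      exact (Submodule.Quotient.mk_eq_zero P).2 (hPinv u hu _ (section_mkQ_sub_mem hs y))
    have hdim := Submodule.finrank_quotient_add_finrank P
    have hPk : Module.finrank K P = k := by
      rw [hP, finrank_span_eq_card he, Fintype.card_fin]
    have : Nontrivial (E ⧸ P) := Module.nontrivial_of_finrank_pos (R := K) (by omega)
    obtain ⟨z, hz, hkill⟩ := IsNilSpace.exists_common_kernel (V := V.map (compress P.mkQ s))
      (by
        rintro _ ⟨u, hu, rfl⟩
        exact isNilpotent_compress_of_quotient hs (hV u hu) (hint u hu))
      (by
        rintro _ ⟨u, hu, rfl⟩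
        refine ⟨u * u, hsq u hu, LinearMap.ext fun y => ?_⟩
        simp only [compress_apply, Module.End.mul_apply]
        rw [hint u hu])
    obtain ⟨z, rfl⟩ := P.mkQ_surjective z
    have hzP : z ∉ P := fun h => hz ((Submodule.Quotient.mk_eq_zero P).2 h)
    refine ⟨Fin.snoc e z, linearIndependent_finSnoc.2 ⟨he, hzP⟩, fun u hu j => ?_⟩
    induction j using Fin.lastCases with
    | last =>
      have h := hkill _ ⟨u, hu, rfl⟩
      rw [compress_apply, hint u hu] at h
      rw [Fin.snoc_last]
      refine Submodule.span_mono ?_ ((Submodule.Quotient.mk_eq_zero P).1 h)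
      rintro _ ⟨i, rfl⟩
      exact ⟨i.castSucc, Fin.castSucc_lt_last i, by simp⟩
    | cast j =>
      rw [Fin.snoc_castSucc]
      refine Submodule.span_mono ?_ (hflag u hu j)
      rintro _ ⟨i, hi, rfl⟩
      exact ⟨i.castSucc, by simpa using hi, by simp⟩

end Triangularization

/-! ### Strictly upper triangular matrices -/

section Matrices

open Matrix Polynomial

variable {K : Type*} [Field K] {n : ℕ}

/-- The space of strictly upper triangular matrices. -/
def strictUpper (K : Type*) [Field K] (n : ℕ) : Submodule K (Matrix (Fin n) (Fin n) K) where
  carrier := {M | ∀ i j, j ≤ i → M i j = 0}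
  add_mem' hA hB i j h := by simp [hA i j h, hB i j h]
  zero_mem' _ _ _ := rfl
  smul_mem' c A hA i j h := by simp [hA i j h]

theorem single_mem_strictUpper {i j : Fin n} (h : i < j) :
    Matrix.single i j (1 : K) ∈ strictUpper K n := by
  intro r s hsr
  refine Matrix.single_apply_of_ne _ _ _ _ _ ?_
  rintro ⟨rfl, rfl⟩
  exact absurd h (not_lt.2 hsr)

theorem mul_mem_strictUpper {A B : Matrix (Fin n) (Fin n) K} (hA : A ∈ strictUpper K n)
    (hB : B ∈ strictUpper K n) : A * B ∈ strictUpper K n := by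
  intro i j hji
  rw [Matrix.mul_apply]
  refine Finset.sum_eq_zero fun k _ => ?_
  rcases le_or_gt k i with h | h
  · rw [hA i k h, zero_mul]
  · rw [hB k j (hji.trans h.le), mul_zero]

theorem _root_.IsNilpotent.matrix_pow_eq_zero {A : Matrix (Fin n) (Fin n) K} (h : IsNilpotent A) :
    A ^ n = 0 := by
  have h1 := (Matrix.isNilpotent_charpoly_sub_pow_of_isNilpotent h).eq_zero
  have h2 := Matrix.aeval_self_charpoly A
  rw [sub_eq_zero.1 h1] at h2
  simpa using h2

theorem isNilpotent_of_mem_strictUpper {A : Matrix (Fin n) (Fin n) K}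
    (hA : A ∈ strictUpper K n) : IsNilpotent A := by
  have h : A.charpoly = X ^ n := by
    rw [Matrix.charpoly_of_isUpperTriangular A fun i j hij => hA i j (le_of_lt hij)]
    simp [hA _ _ le_rfl]
  refine ⟨n, ?_⟩
  have h2 := Matrix.aeval_self_charpoly A
  rw [h] at h2
  simpa using h2

theorem diag_eq_zero_of_isNilpotent {A : Matrix (Fin n) (Fin n) K} (hA : IsNilpotent A)
    (hup : ∀ i j, j < i → A i j = 0) (i : Fin n) : A i i = 0 := by
  have h1 := (Matrix.isNilpotent_charpoly_sub_pow_of_isNilpotent hA).eq_zero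
  rw [Matrix.charpoly_of_isUpperTriangular A fun i j hij => hup i j hij, sub_eq_zero] at h1
  have h2 := congrArg (Polynomial.eval (A i i)) h1
  rw [Polynomial.eval_prod, Finset.prod_eq_zero (Finset.mem_univ i) (by simp)] at h2
  simp only [eval_pow, eval_X] at h2
  exact eq_zero_of_pow_eq_zero h2.symm

theorem mem_strictUpper_of_isNilpotent {A : Matrix (Fin n) (Fin n) K} (hA : IsNilpotent A)
    (hup : ∀ i j, j < i → A i j = 0) : A ∈ strictUpper K n := by
  intro i j hji
  rcases hji.lt_or_eq with h | rfl
  · exact hup i j h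
  · exact diag_eq_zero_of_isNilpotent hA hup j

/-- Gerstenhaber's bound for matrices. -/
theorem finrank_le_choose_of_isNilpotent [CharZero K]
    {S : Submodule K (Matrix (Fin n) (Fin n) K)} (hS : ∀ A ∈ S, IsNilpotent A) :
    Module.finrank K S ≤ n.choose 2 := by
  have h := IsNilSpace.finrank_le_choose (n := n) (V := S.map (Matrix.toLin' (R := K)).toLinearMap)
    (by simp) (by
      rintro _ ⟨A, hA, rfl⟩
      exact (hS A hA).map (Matrix.toLinAlgEquiv' (R := K)))
  rwa [LinearEquiv.finrank_map_eq] at h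

/-- The case of equality in Gerstenhaber's theorem. -/
theorem exists_conj_mem_strictUpper [CharZero K]
    {S : Submodule K (Matrix (Fin n) (Fin n) K)} (hS : ∀ A ∈ S, IsNilpotent A)
    (hdim : Module.finrank K S = n.choose 2) :
    ∃ P Q : Matrix (Fin n) (Fin n) K, P * Q = 1 ∧ Q * P = 1 ∧
      ∀ A ∈ S, Q * A * P ∈ strictUpper K n := by
  set V := S.map (Matrix.toLin' (R := K)).toLinearMap with hVdef
  have hV : IsNilSpace V := by
    rintro _ ⟨A, hA, rfl⟩
    exact (hS A hA).map (Matrix.toLinAlgEquiv' (R := K))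
  have hVdim : Module.finrank K V = n.choose 2 := by
    rw [hVdef, LinearEquiv.finrank_map_eq, hdim]
  obtain ⟨e, he, hflag⟩ := hV.exists_flag (fun u hu => hV.mul_self_mem (by simp) hVdim hu) n
    (by simp)
  let b := basisOfLinearIndependentOfCardEqFinrank' e he (by simp)
  have hb : ∀ j, b j = e j := fun j => by simp [b]
  let c := Pi.basisFun K (Fin n)
  refine ⟨c.toMatrix b, b.toMatrix c, c.toMatrix_mul_toMatrix_flip b,
    b.toMatrix_mul_toMatrix_flip c, fun A hA i j hji => ?_⟩
  have h1 : b.toMatrix c * A * c.toMatrix b = LinearMap.toMatrix b b (Matrix.toLin' A) := by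
    rw [← basis_toMatrix_mul_linearMap_toMatrix_mul_basis_toMatrix (b := b) (b' := c) (c := b)
      (c' := c), LinearMap.toMatrix_eq_toMatrix', LinearMap.toMatrix'_toLin']
  rw [h1, LinearMap.toMatrix_apply]
  have h2 := hflag _ ⟨A, hA, rfl⟩ j
  have h3 : e '' {i | i < j} = b '' {i | i < j} := by
    ext; simp [hb]
  rw [h3, Module.Basis.mem_span_image] at h2
  rw [hb]
  by_contra h
  have : i ∈ {i | i < j} := h2 (by simpa using h)
  exact absurd this (not_lt.2 hji)

theorem isNilpotent_of_infinite_left {A B : Matrix (Fin n) (Fin n) K}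
    (h : {t : K | IsNilpotent (A + t • B)}.Infinite) : IsNilpotent A := by
  let p : Matrix (Fin n) (Fin n) K[X] := A.map C + (X : K[X]) • B.map C
  have hp : ∀ t, (evalRingHom t).mapMatrix p = A + t • B := by
    intro t; ext i j; simp [p]; ring
  have hz : p ^ n = 0 := by
    ext1 i j
    refine Polynomial.eq_zero_of_infinite_isRoot _ (h.mono fun t ht => ?_)
    have h1 : (evalRingHom t).mapMatrix (p ^ n) = 0 := by
      rw [map_pow, hp, IsNilpotent.matrix_pow_eq_zero ht]
    exact congrFun (congrFun h1 i) j
  refine ⟨n, ?_⟩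
  have := hp 0
  rw [zero_smul, add_zero] at this
  rw [← this, ← map_pow, hz, map_zero]

theorem isNilpotent_of_infinite_right {A B : Matrix (Fin n) (Fin n) K}
    (h : {t : K | IsNilpotent (A + t • B)}.Infinite) : IsNilpotent B := by
  refine isNilpotent_of_infinite_left (A := B) (B := A) ?_
  have h1 : ({t : K | IsNilpotent (A + t • B)} \ {0}).Infinite := h.sdiff (Set.finite_singleton 0)
  refine (h1.image (f := fun t => t⁻¹) fun a _ b _ hab => inv_injective hab).mono ?_
  rintro _ ⟨t, ⟨ht, ht0⟩, rfl⟩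
  have ht0' : t ≠ 0 := ht0
  have e : B + t⁻¹ • A = t⁻¹ • (A + t • B) := by
    rw [smul_add, smul_smul, inv_mul_cancel₀ ht0', one_smul, add_comm]
  change IsNilpotent (B + t⁻¹ • A)
  rw [e]
  exact IsNilpotent.smul ht _

end Matrices

/-! ### Pencils of triangularizable spaces -/

section Pencil

open Matrix

variable {K D : Type*} [Field K] [AddCommGroup D] [Module K D] {n : ℕ}

theorem single_mul_apply_eq (i j r s : Fin n) (M : Matrix (Fin n) (Fin n) K) :
    (Matrix.single i j (1 : K) * M) r s = if r = i then M j s else 0 := by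
  split_ifs with h
  · subst h; simp
  · simp [h]

theorem mul_single_apply_eq (i j r s : Fin n) (M : Matrix (Fin n) (Fin n) K) :
    (M * Matrix.single i j (1 : K)) r s = if s = j then M r i else 0 := by
  split_ifs with h
  · subst h; simp
  · simp [h]

/-- Let `d ↦ N₀ d` parametrize all strictly upper triangular matrices, and suppose that for
infinitely many `t` the spaces `{N₀ d + t N₁ d}` are simultaneously strictly triangularizable, in
the weak form that the difference of a product of two members and a third member is nilpotent.
Then all `N₁ d` are strictly upper triangular.

Differentiating the closure under products at `t = 0` shows that `N₀ d ↦ N₁ d` is a derivation up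
to strictly upper triangular terms. The entry of `N₁ d` in position `(i, j)`, where `j < i` and
`N₀ d` is the matrix unit at `(k, l)`, is shown to vanish by downward induction on
`(l - k) + (i - j)`: it is a diagonal entry of a nilpotent upper triangular matrix. -/
theorem mem_strictUpper_of_pencil (N₀ N₁ : D →ₗ[K] Matrix (Fin n) (Fin n) K)
    (h₀ : ∀ d, N₀ d ∈ strictUpper K n) (hsurj : ∀ A ∈ strictUpper K n, ∃ d, N₀ d = A)
    {T : Set K} (hT : T.Infinite)
    (hprod : ∀ t ∈ T, ∀ d₁ d₂ d₃, IsNilpotent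
      ((N₀ d₁ + t • N₁ d₁) * (N₀ d₂ + t • N₁ d₂) - (N₀ d₃ + t • N₁ d₃))) (d : D) :
    N₁ d ∈ strictUpper K n := by
  have hnil : ∀ d, IsNilpotent (N₁ d) := fun d => by
    refine isNilpotent_of_infinite_right (A := N₀ d) (hT.mono fun t ht => ?_)
    have h := hprod t ht 0 0 d
    simp only [map_zero, smul_zero, add_zero, mul_zero, zero_sub] at h
    simpa using h.neg
  have hup : ∀ d, (∀ i j, j < i → N₁ d i j = 0) → N₁ d ∈ strictUpper K n :=
    fun d h => mem_strictUpper_of_isNilpotent (hnil d) h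
  have hT' : (T \ {0}).Infinite := hT.sdiff (Set.finite_singleton 0)
  -- The derivative at `t = 0` of the closure under products.
  have hder : ∀ d₁ d₂ d₃, N₀ d₃ = N₀ d₁ * N₀ d₂ →
      IsNilpotent (N₀ d₁ * N₁ d₂ + N₁ d₁ * N₀ d₂ - N₁ d₃) := by
    intro d₁ d₂ d₃ h
    refine isNilpotent_of_infinite_left (B := N₁ d₁ * N₁ d₂) (hT'.mono fun t ht => ?_)
    have ht0 : t ≠ 0 := ht.2
    have e : N₀ d₁ * N₁ d₂ + N₁ d₁ * N₀ d₂ - N₁ d₃ + t • (N₁ d₁ * N₁ d₂) =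
        t⁻¹ • ((N₀ d₁ + t • N₁ d₁) * (N₀ d₂ + t • N₁ d₂) - (N₀ d₃ + t • N₁ d₃)) := by
      rw [eq_inv_smul_iff₀ ht0, h]
      simp only [add_mul, mul_add, smul_mul_assoc, mul_smul_comm, smul_add, smul_sub]
      abel
    change IsNilpotent _
    rw [e]
    exact (hprod t ht.1 d₁ d₂ d₃).smul _
  have hker : ∀ d, N₀ d = 0 → ∀ i j, j < i → N₁ d i j = 0 := by
    intro d hd i j hij
    obtain ⟨d', hd'⟩ := hsurj _ (single_mem_strictUpper (K := K) hij)
    have h := hder d d' 0 (by simp [hd])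
    rw [hd, hd', zero_mul, zero_add, map_zero, sub_zero] at h
    have h2 := (Matrix.isNilpotent_trace_of_isNilpotent h).eq_zero
    rw [Matrix.trace_mul_single] at h2
    simpa using h2
  have hunit : ∀ m, ∀ k l : Fin n, k < l → ∀ d, N₀ d = Matrix.single k l 1 → ∀ i j, j < i →
      2 * n ≤ m + (l.val - k.val) + (i.val - j.val) → N₁ d i j = 0 := by
    intro m
    induction m with
    | zero => intro k l hkl d _ i j hij h; omega
    | succ m ih =>
      intro k l hkl d hd i j hij h
      obtain ⟨d', hd'⟩ := hsurj _ (single_mem_strictUpper (K := K) hij)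
      rw [Fin.lt_def] at hkl hij
      by_cases hjl : j = l
      · subst hjl
        have hki : k < i := Fin.lt_def.2 (by omega)
        obtain ⟨d₃, hd₃⟩ := hsurj _ (single_mem_strictUpper (K := K) hki)
        have hd₃' : N₁ d₃ ∈ strictUpper K n := hup _ fun r s hrs => by
          have := Fin.lt_def.1 hrs
          exact ih k i hki d₃ hd₃ r s hrs (by omega)
        have hn := hder d d' d₃ (by rw [hd, hd', hd₃]; simp)
        rw [hd, hd'] at hn
        have hz := diag_eq_zero_of_isNilpotent hn (fun r s hsr => by
          rw [Matrix.sub_apply, Matrix.add_apply, single_mul_apply_eq, mul_single_apply_eq,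
            hd₃' r s hsr.le, sub_zero]
          rw [Fin.lt_def] at hsr
          split_ifs with h1 h2 h2
          · subst h1 h2; omega
          · subst h1
            rw [ih j i hij d' hd' j s (Fin.lt_def.2 (by omega)) (by omega), add_zero]
          · subst h2
            rw [ih k j hkl d hd r j (Fin.lt_def.2 (by omega)) (by omega), add_zero]
          · rw [add_zero]) i
        rw [Matrix.sub_apply, Matrix.add_apply, single_mul_apply_eq, mul_single_apply_eq,
            hd₃' i i le_rfl, sub_zero, if_neg (by omega), if_pos rfl, zero_add] at hz
        exact hz
      · obtain ⟨d₃, hd₃, hd₃'⟩ : ∃ d₃, N₀ d₃ = N₀ d' * N₀ d ∧ N₁ d₃ ∈ strictUpper K n := by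
          by_cases hik : i = k
          · subst hik
            have hjl' : j < l := Fin.lt_def.2 (by omega)
            obtain ⟨d₃, hd₃⟩ := hsurj _ (single_mem_strictUpper (K := K) hjl')
            refine ⟨d₃, by rw [hd, hd', hd₃]; simp, hup _ fun r s hrs => ?_⟩
            have := Fin.lt_def.1 hrs
            exact ih j l hjl' d₃ hd₃ r s hrs (by omega)
          · refine ⟨0, ?_, by simp⟩
            rw [hd, hd', map_zero, Matrix.single_mul_single_of_ne _ _ _ _ hik]
        have hn := hder d' d d₃ hd₃
        rw [hd, hd'] at hn
        have hz := diag_eq_zero_of_isNilpotent hn (fun r s hsr => by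
          rw [Matrix.sub_apply, Matrix.add_apply, single_mul_apply_eq, mul_single_apply_eq,
            hd₃' r s hsr.le, sub_zero]
          rw [Fin.lt_def] at hsr
          have e1 : r = j → N₁ d i s = 0 := by
            rintro rfl
            exact ih k l hkl d hd i s (Fin.lt_def.2 (by omega)) (by omega)
          have e2 : s = l → N₁ d' r k = 0 := by
            rintro rfl
            exact ih j i hij d' hd' r k (Fin.lt_def.2 (by omega)) (by omega)
          split_ifs with h1 h2 h2
          · rw [e1 h1, e2 h2, add_zero]
          · rw [e1 h1, add_zero]
          · rw [e2 h2, add_zero]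
          · rw [add_zero]) j
        rw [Matrix.sub_apply, Matrix.add_apply, single_mul_apply_eq, mul_single_apply_eq,
            hd₃' j j le_rfl, sub_zero, if_pos rfl, if_neg hjl, add_zero] at hz
        exact hz
  -- `N₀ d` is a combination of matrix units, so `d` is, up to the kernel of `N₀`, a combination of
  -- elements covered by `hunit`.
  choose! δ hδ using fun p : Fin n × Fin n => fun hp : p.1 < p.2 =>
    hsurj _ (single_mem_strictUpper (K := K) hp)
  refine hup d fun i j hij => ?_
  let c : D := ∑ k, ∑ l, N₀ d k l • δ (k, l)
  have hc : N₀ (d - c) = 0 := by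
    rw [map_sub, sub_eq_zero]
    conv_lhs => rw [Matrix.matrix_eq_sum_single (N₀ d)]
    simp only [c, map_sum, map_smul]
    refine Finset.sum_congr rfl fun k _ => Finset.sum_congr rfl fun l _ => ?_
    rcases lt_or_ge k l with hkl | hkl
    · rw [hδ (k, l) hkl, Matrix.smul_single, smul_eq_mul, mul_one]
    · rw [h₀ d k l hkl, zero_smul, Matrix.single_zero]
  have hd : N₁ d = N₁ (d - c) + N₁ c := by rw [← map_add, sub_add_cancel]
  rw [hd, Matrix.add_apply, hker _ hc i j hij, zero_add]
  simp only [c, map_sum, map_smul, Matrix.sum_apply, Matrix.smul_apply]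
  refine Finset.sum_eq_zero fun k _ => Finset.sum_eq_zero fun l _ => ?_
  rcases lt_or_ge k l with hkl | hkl
  · rw [hunit (2 * n) k l hkl _ (hδ (k, l) hkl) i j hij (by omega), smul_zero]
  · rw [h₀ d k l hkl, zero_smul]

end Pencil

/-! ### Matrices of functionals -/

section Pairing

open Matrix

variable {K Y : Type*} [Field K] [AddCommGroup Y] [Module K Y] {n : ℕ}

/-- The matrix `(f (w i j))` of the values of a functional `f` on a square array `w` of vectors. -/
def pairing (w : Fin n → Fin n → Y) : Module.Dual K Y →ₗ[K] Matrix (Fin n) (Fin n) K where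
  toFun f := Matrix.of fun i j => f (w i j)
  map_add' f g := by ext; simp
  map_smul' c f := by ext; simp

@[simp] theorem pairing_apply (w : Fin n → Fin n → Y) (f : Module.Dual K Y) (i j : Fin n) :
    pairing w f i j = f (w i j) := rfl

theorem finrank_range_pairing (w : Fin n → Fin n → Y) :
    Module.finrank K (LinearMap.range (pairing (K := K) w)) =
      Module.finrank K (Submodule.span K (Set.range fun p : Fin n × Fin n => w p.1 p.2)) := by
  set W := Submodule.span K (Set.range fun p : Fin n × Fin n => w p.1 p.2) with hW
  have hw : ∀ i j, w i j ∈ W := fun i j => Submodule.subset_span ⟨(i, j), rfl⟩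
  have : FiniteDimensional K W := FiniteDimensional.span_of_finite K (Set.finite_range _)
  let g : Module.Dual K W →ₗ[K] Matrix (Fin n) (Fin n) K := pairing fun i j => ⟨w i j, hw i j⟩
  have hr : LinearMap.range (pairing (K := K) w) = LinearMap.range g := by
    ext A; constructor
    · rintro ⟨f, rfl⟩; exact ⟨f ∘ₗ W.subtype, rfl⟩
    · rintro ⟨f, rfl⟩
      obtain ⟨f', rfl⟩ := LinearMap.exists_extend f
      exact ⟨f', rfl⟩
  have hg : Function.Injective g := by
    rw [injective_iff_map_eq_zero]
    intro f hf
    obtain ⟨f', rfl⟩ := LinearMap.exists_extend f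
    have hle : W ≤ LinearMap.ker f' := by
      rw [hW, Submodule.span_le]
      rintro _ ⟨⟨i, j⟩, rfl⟩
      exact congrFun (congrFun hf i) j
    ext ⟨y, hy⟩
    exact hle hy
  rw [hr, LinearMap.finrank_range_of_inj hg, Subspace.dual_finrank_eq]

theorem isNilpotent_conj_iff {P Q : Matrix (Fin n) (Fin n) K} (hPQ : P * Q = 1) (hQP : Q * P = 1)
    {A : Matrix (Fin n) (Fin n) K} : IsNilpotent (Q * A * P) ↔ IsNilpotent A := by
  have h : ∀ k, (Q * A * P) ^ k = Q * A ^ k * P := by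
    intro k
    induction k with
    | zero => simp [hQP]
    | succ k ih =>
      calc (Q * A * P) ^ (k + 1) = Q * A ^ k * (P * Q) * A * P := by
            rw [pow_succ, ih]; simp only [mul_assoc]
        _ = Q * A ^ (k + 1) * P := by rw [hPQ, pow_succ]; simp only [mul_assoc, one_mul]
  constructor
  · rintro ⟨m, hm⟩
    refine ⟨m, ?_⟩
    rw [h] at hm
    calc A ^ m = (P * Q) * A ^ m * (P * Q) := by rw [hPQ, one_mul, mul_one]
      _ = P * (Q * A ^ m * P) * Q := by simp only [mul_assoc]
      _ = 0 := by rw [hm, mul_zero, zero_mul]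
  · rintro ⟨m, hm⟩
    exact ⟨m, by rw [h, hm, mul_zero, zero_mul]⟩

theorem conj_mul_sub {P Q A B C : Matrix (Fin n) (Fin n) K} (hPQ : P * Q = 1) :
    Q * (A * B - C) * P = (Q * A * P) * (Q * B * P) - Q * C * P := by
  have : (Q * A * P) * (Q * B * P) = Q * A * (P * Q) * B * P := by simp only [mul_assoc]
  rw [this, hPQ, mul_one, mul_sub, sub_mul, mul_assoc Q A B]

end Pairing

/-! ### Generic vectors -/

section Generic

variable {X : Type*} [AddCommGroup X] [Module ℂ X]

/-- Linear independence persists along a line, up to finitely many parameters. -/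
theorem finite_setOf_not_linearIndependent {K Y : Type*} [Field K] [AddCommGroup Y] [Module K Y]
    {m : ℕ} {p : Fin m → Y} (hp : LinearIndependent K p) (q : Fin m → Y) :
    {t : K | ¬ LinearIndependent K fun i => p i + t • q i}.Finite := by
  classical
  obtain ⟨g, hg⟩ := (Fintype.linearCombination K p).exists_leftInverse_of_injective
    (LinearMap.ker_eq_bot.2 hp.fintypeLinearCombination_injective)
  have hgp : ∀ i, g (p i) = Pi.single i 1 := fun i => by
    have := LinearMap.congr_fun hg (Pi.single i 1)
    simpa using this
  let R : Matrix (Fin m) (Fin m) K := Matrix.of fun i => g (q i)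
  let N : Matrix (Fin m) (Fin m) (Polynomial K) :=
    1 + (Polynomial.X : Polynomial K) • R.map Polynomial.C
  have hN : ∀ t, (Polynomial.evalRingHom t).mapMatrix N = 1 + t • R := by
    intro t
    rw [map_add, map_one]
    congr 1
    ext i j; simp; ring
  have hdet : ∀ t, N.det.eval t = (1 + t • R).det := by
    intro t
    rw [← hN, ← RingHom.map_det]; rfl
  have hne : N.det ≠ 0 := by
    intro h
    have := hdet 0
    simp [h] at this
  refine (Polynomial.finite_setOfPred_isRoot hne).subset fun t ht => ?_
  by_contra hroot
  refine ht (LinearIndependent.of_comp g ?_)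
  have hu : IsUnit (1 + t • R) := by
    rw [Matrix.isUnit_iff_isUnit_det, isUnit_iff_ne_zero, ← hdet]
    exact hroot
  have := Matrix.linearIndependent_rows_iff_isUnit.2 hu
  have e : (g ∘ fun i => p i + t • q i) = (1 + t • R).row := by
    ext i j
    simp [hgp, R, Matrix.one_apply, Pi.single_apply, eq_comm]
  rw [e]
  exact this

theorem finrank_orbit_le (W : Submodule ℂ (Module.End ℂ X)) [FiniteDimensional ℂ W] (ζ : X) :
    Module.finrank ℂ (orbit W ζ) ≤ Module.finrank ℂ W :=
  Submodule.finrank_map_le _ _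

theorem bddAbove_finrank_orbit (W : Submodule ℂ (Module.End ℂ X)) [FiniteDimensional ℂ W] :
    BddAbove (Set.range fun ζ : X => Module.finrank ℂ (orbit W ζ)) := by
  refine ⟨Module.finrank ℂ W, ?_⟩
  rintro _ ⟨ζ, rfl⟩
  exact finrank_orbit_le W ζ

theorem finrank_orbit_le_lDim (W : Submodule ℂ (Module.End ℂ X)) [FiniteDimensional ℂ W] (ζ : X) :
    Module.finrank ℂ (orbit W ζ) ≤ lDim W :=
  le_csSup (bddAbove_finrank_orbit W) ⟨ζ, rfl⟩

theorem exists_finrank_orbit_eq_lDim (W : Submodule ℂ (Module.End ℂ X)) [FiniteDimensional ℂ W] :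
    ∃ ζ : X, Module.finrank ℂ (orbit W ζ) = lDim W :=
  Nat.sSup_mem (Set.range_nonempty _) (bddAbove_finrank_orbit W)

theorem lDim_le_finrank (W : Submodule ℂ (Module.End ℂ X)) [FiniteDimensional ℂ W] :
    lDim W ≤ Module.finrank ℂ W := by
  obtain ⟨ζ, hζ⟩ := exists_finrank_orbit_eq_lDim W
  exact hζ ▸ finrank_orbit_le W ζ

/-- The local dimension, once attained at a point, is attained along each line through that point,
up to finitely many parameters. -/
theorem finite_setOf_finrank_orbit_ne (W : Submodule ℂ (Module.End ℂ X)) [FiniteDimensional ℂ W]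
    {ζ : X} (hζ : Module.finrank ℂ (orbit W ζ) = lDim W) (η : X) :
    {t : ℂ | Module.finrank ℂ (orbit W (ζ + t • η)) ≠ lDim W}.Finite := by
  have hfd : ∀ ξ, FiniteDimensional ℂ (orbit W ξ) := fun ξ => by unfold orbit; infer_instance
  let b := Module.finBasis ℂ (orbit W ζ)
  have hb : LinearIndependent ℂ fun i => (b i : X) :=
    b.linearIndependent.map' (orbit W ζ).subtype (Submodule.ker_subtype _)
  choose S hSW hS using fun i => (b i).2
  have hS' : ∀ i, S i ζ = b i := hS
  refine (finite_setOf_not_linearIndependent hb fun i => S i η).subset fun t ht hind => ht ?_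
  refine le_antisymm (finrank_orbit_le_lDim W _) ?_
  have hle : Submodule.span ℂ (Set.range fun i => (b i : X) + t • S i η) ≤
      orbit W (ζ + t • η) := by
    rw [Submodule.span_le]
    rintro _ ⟨i, rfl⟩
    exact ⟨S i, hSW i, by simp [hS']⟩
  have := Submodule.finrank_mono hle
  rwa [finrank_span_eq_card hind, Fintype.card_fin, hζ] at this

theorem exists_generic (W₁ W₂ : Submodule ℂ (Module.End ℂ X)) [FiniteDimensional ℂ W₁]
    [FiniteDimensional ℂ W₂] : ∃ ζ : X, Module.finrank ℂ (orbit W₁ ζ) = lDim W₁ ∧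
      Module.finrank ℂ (orbit W₂ ζ) = lDim W₂ := by
  obtain ⟨ζ₁, h₁⟩ := exists_finrank_orbit_eq_lDim W₁
  obtain ⟨ζ₂, h₂⟩ := exists_finrank_orbit_eq_lDim W₂
  have f₁ := finite_setOf_finrank_orbit_ne W₁ h₁ (ζ₂ - ζ₁)
  have f₂ := (finite_setOf_finrank_orbit_ne W₂ h₂ (ζ₂ - ζ₁)).preimage
    (f := fun t : ℂ => t - 1) (sub_left_injective.injOn)
  obtain ⟨t, ht⟩ := (f₁.union f₂).infinite_compl.nonempty
  simp only [Set.mem_compl_iff, Set.mem_union, not_or, Set.mem_ofPred_eq, not_not,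
    Set.mem_preimage] at ht
  refine ⟨ζ₁ + t • (ζ₂ - ζ₁), ht.1, ?_⟩
  have e : ζ₁ + t • (ζ₂ - ζ₁) = ζ₂ + (t - 1) • (ζ₂ - ζ₁) := by
    rw [sub_smul, one_smul]; abel
  rw [e]; exact ht.2

end Generic

/-! ### Elementary operators -/

section ElementaryOperator

open Matrix

variable {X : Type*} [AddCommGroup X] [Module ℂ X]
  {A : NonUnitalSubalgebra ℂ (Module.End ℂ X)} {n : ℕ}

theorem finiteDimensional_spaceL (a : Fin n → Module.End ℂ X) :
    FiniteDimensional ℂ (spaceL a) :=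
  FiniteDimensional.span_of_finite ℂ (Set.finite_range _)

theorem finiteDimensional_spaceV (a b : Fin n → Module.End ℂ X) :
    FiniteDimensional ℂ (spaceV a b) :=
  FiniteDimensional.span_of_finite ℂ (Set.finite_range _)

theorem orbit_spaceL (a : Fin n → Module.End ℂ X) (ζ : X) :
    orbit (spaceL a) ζ = Submodule.span ℂ (Set.range fun i => a i ζ) := by
  rw [orbit, spaceL, Submodule.map_span, ← Set.range_comp]; rfl

theorem orbit_spaceV (a b : Fin n → Module.End ℂ X) (ζ : X) :
    orbit (spaceV a b) ζ =
      Submodule.span ℂ (Set.range fun p : Fin n × Fin n => b p.1 (a p.2 ζ)) := by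
  rw [orbit, spaceV, Submodule.map_span, ← Set.range_comp]; rfl

/-- The matrix `(f (b_i a_j ζ))` attached to a functional `f` on `X` and a vector `ζ`. -/
noncomputable def localMatrix (a b : Fin n → Module.End ℂ X) (ζ : X) :
    Module.Dual ℂ X →ₗ[ℂ] Matrix (Fin n) (Fin n) ℂ :=
  pairing fun i j => b i (a j ζ)

@[simp] theorem localMatrix_apply (a b : Fin n → Module.End ℂ X) (ζ : X) (f : Module.Dual ℂ X)
    (i j : Fin n) : localMatrix a b ζ f i j = f (b i (a j ζ)) := rfl

theorem localMatrix_add_smul (a b : Fin n → Module.End ℂ X) (ζ η : X) (t : ℂ)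
    (f : Module.Dual ℂ X) :
    localMatrix a b (ζ + t • η) f = localMatrix a b ζ f + t • localMatrix a b η f := by
  ext; simp

theorem finrank_range_localMatrix (a b : Fin n → Module.End ℂ X) (ζ : X) :
    Module.finrank ℂ (LinearMap.range (localMatrix a b ζ)) =
      Module.finrank ℂ (orbit (spaceV a b) ζ) := by
  rw [localMatrix, finrank_range_pairing, orbit_spaceV]

theorem linearIndependent_of_finrank_orbit {a : Fin n → Module.End ℂ X} {ζ : X}
    (h : Module.finrank ℂ (orbit (spaceL a) ζ) = n) : LinearIndependent ℂ fun i => a i ζ := by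
  rw [linearIndependent_iff_card_eq_finrank_span, Fintype.card_fin, Set.finrank, ← orbit_spaceL, h]

/-- By density, each functional `f` on `V(φ) ζ` is realized by some `x ∈ A` acting on `V(φ) ζ` as
`f ⊗ ζ`. In the basis `a_1 ζ, …, a_n ζ` the matrix of `φ x` on `L(φ) ζ` is then `(f (b_i a_j ζ))`,
which is therefore nilpotent. -/
theorem isNilpotent_localMatrix (hA : IsDenseAlgebra A) {φ : A →ₗ[ℂ] Module.End ℂ X}
    {a b : Fin n → Module.End ℂ X} (hφ : IsRepresentation φ a b)
    (hnil : LocallyNilpotentCond φ a b) {ζ : X} (hζ : LinearIndependent ℂ fun i => a i ζ)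
    (f : Module.Dual ℂ X) : IsNilpotent (localMatrix a b ζ f) := by
  have := finiteDimensional_spaceV a b
  have : FiniteDimensional ℂ (orbit (spaceV a b) ζ) := by unfold orbit; infer_instance
  let β := Module.finBasis ℂ (orbit (spaceV a b) ζ)
  have hβ : LinearIndependent ℂ fun i => (β i : X) :=
    β.linearIndependent.map' (orbit (spaceV a b) ζ).subtype (Submodule.ker_subtype _)
  obtain ⟨x, hxA, hx⟩ := hA _ (fun i => (β i : X)) (fun i => f (β i) • ζ) hβ
  have hxW : ∀ w ∈ orbit (spaceV a b) ζ, x w = f w • ζ := by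
    intro w hw
    have h : x ∘ₗ (orbit (spaceV a b) ζ).subtype =
        (LinearMap.smulRight f ζ) ∘ₗ (orbit (spaceV a b) ζ).subtype :=
      β.ext fun i => by simpa using hx i
    exact LinearMap.congr_fun h ⟨w, hw⟩
  obtain ⟨hinv, m, hm⟩ := hnil ζ ⟨x, hxA⟩ (by
    rintro _ ⟨w, hw, rfl⟩
    exact Submodule.mem_span_singleton.2 ⟨f w, (hxW w hw).symm⟩)
  have hmem : ∀ i j, b i (a j ζ) ∈ orbit (spaceV a b) ζ := fun i j => by
    rw [orbit_spaceV]; exact Submodule.subset_span ⟨(i, j), rfl⟩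
  let τ : (Fin n → ℂ) →ₗ[ℂ] X := Fintype.linearCombination ℂ fun i => a i ζ
  have hτinj : Function.Injective τ := hζ.fintypeLinearCombination_injective
  have hτ : ∀ c, φ ⟨x, hxA⟩ (τ c) = τ (Matrix.toLin' (localMatrix a b ζ f) c) := by
    intro c
    have h1 : ∀ j, φ ⟨x, hxA⟩ (a j ζ) = ∑ i, f (b i (a j ζ)) • a i ζ := by
      intro j
      have : φ ⟨x, hxA⟩ (a j ζ) = ∑ i, a i (x (b i (a j ζ))) := by
        rw [hφ]
        simp [M, LinearMap.sum_apply]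
      rw [this]
      exact Finset.sum_congr rfl fun i _ => by rw [hxW _ (hmem i j), map_smul]
    simp only [τ, Fintype.linearCombination_apply, map_sum, map_smul, h1, Matrix.toLin'_apply,
      Matrix.mulVec, dotProduct, localMatrix_apply, Finset.sum_smul, Finset.smul_sum, smul_smul]
    rw [Finset.sum_comm]
    simp only [mul_comm]
  have hpow : ∀ k c, (φ ⟨x, hxA⟩ ^ k) (τ c) = τ ((Matrix.toLin' (localMatrix a b ζ f) ^ k) c) := by
    intro k
    induction k with
    | zero => simp
    | succ k ih => intro c; rw [pow_succ, pow_succ, Module.End.mul_apply, hτ, ih,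
        Module.End.mul_apply]
  have hz : Matrix.toLin' (localMatrix a b ζ f) ^ m = 0 := by
    refine LinearMap.ext fun c => hτinj ?_
    have hc : τ c ∈ orbit (spaceL a) ζ := by
      rw [orbit_spaceL, Fintype.linearCombination_apply]
      exact Submodule.sum_mem _ fun i _ =>
        Submodule.smul_mem _ _ (Submodule.subset_span (Set.mem_range_self i))
    have h2 := congrArg Subtype.val (LinearMap.congr_fun hm ⟨τ c, hc⟩)
    rw [Module.End.pow_restrict] at h2
    rw [← hpow, LinearMap.zero_apply, map_zero]
    exact h2
  refine ⟨m, Matrix.toLin'.injective ?_⟩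
  rw [Matrix.toLin'_pow, hz, map_zero]

/-- `a_1 P_{1j} + ⋯ + a_n P_{nj}`, the change of the family `a` by the columns of `P`. -/
noncomputable def recombine (P : Matrix (Fin n) (Fin n) ℂ) (a : Fin n → Module.End ℂ X) :
    Fin n → Module.End ℂ X := fun j => ∑ k, P k j • a k

theorem isRepresentation_recombine {φ : A →ₗ[ℂ] Module.End ℂ X} {a b : Fin n → Module.End ℂ X}
    (hφ : IsRepresentation φ a b) {P Q : Matrix (Fin n) (Fin n) ℂ} (hPQ : P * Q = 1) :
    IsRepresentation φ (recombine P a) (recombine Qᵀ b) := by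
  rw [IsRepresentation] at hφ ⊢
  rw [hφ]
  ext x ξ
  simp only [M, recombine, LinearMap.sum_apply, LinearMap.coe_mk, AddHom.coe_mk,
    Module.End.mul_apply, LinearMap.smul_apply, map_sum, map_smul, Matrix.transpose_apply,
    Finset.smul_sum, smul_smul]
  have e : ∀ k l, ∑ i, P k i * Q i l = if k = l then 1 else 0 := fun k l => by
    rw [← Matrix.mul_apply, hPQ, Matrix.one_apply]
  symm
  calc ∑ i, ∑ l, ∑ k, (Q i l * P k i) • a k ((x : Module.End ℂ X) (b l ξ))
      = ∑ l, ∑ k, (∑ i, P k i * Q i l) • a k ((x : Module.End ℂ X) (b l ξ)) := by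
        rw [Finset.sum_comm]
        refine Finset.sum_congr rfl fun l _ => ?_
        rw [Finset.sum_comm]
        refine Finset.sum_congr rfl fun k _ => ?_
        rw [Finset.sum_smul]
        simp only [mul_comm]
    _ = _ := by simp [e]

theorem localMatrix_recombine (a b : Fin n → Module.End ℂ X) (P Q : Matrix (Fin n) (Fin n) ℂ)
    (ζ : X) (f : Module.Dual ℂ X) :
    localMatrix (recombine P a) (recombine Qᵀ b) ζ f = Q * localMatrix a b ζ f * P := by
  ext i j
  simp only [localMatrix_apply, recombine, LinearMap.sum_apply, LinearMap.smul_apply, map_sum,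
    map_smul, Matrix.mul_apply, Matrix.transpose_apply, smul_eq_mul, Finset.mul_sum, Finset.sum_mul]
  exact Finset.sum_congr rfl fun k _ => Finset.sum_congr rfl fun l _ => by ring

theorem lDim_spaceV_le (hA : IsDenseAlgebra A) {φ : A →ₗ[ℂ] Module.End ℂ X}
    {a b : Fin n → Module.End ℂ X} (hφ : IsRepresentation φ a b) (hL : lDim (spaceL a) = n)
    (hnil : LocallyNilpotentCond φ a b) : lDim (spaceV a b) ≤ n.choose 2 := by
  have := finiteDimensional_spaceL a
  have := finiteDimensional_spaceV a b
  obtain ⟨ζ, h₁, h₂⟩ := exists_generic (spaceL a) (spaceV a b)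
  rw [← h₂, ← finrank_range_localMatrix]
  refine finrank_le_choose_of_isNilpotent ?_
  rintro _ ⟨f, rfl⟩
  exact isNilpotent_localMatrix hA hφ hnil (linearIndependent_of_finrank_orbit (h₁.trans hL)) f

/-- In the extremal case the flags that triangularize the spaces of matrices `(f (b_i a_j ζ))`, for
generic `ζ`, do not depend on `ζ`. -/
theorem exists_recombine_mul_eq_zero (hA : IsDenseAlgebra A) {φ : A →ₗ[ℂ] Module.End ℂ X}
    {a b : Fin n → Module.End ℂ X} (hφ : IsRepresentation φ a b) (hL : lDim (spaceL a) = n)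
    (hnil : LocallyNilpotentCond φ a b) (hV : lDim (spaceV a b) = n.choose 2) :
    ∃ P Q : Matrix (Fin n) (Fin n) ℂ, P * Q = 1 ∧ Q * P = 1 ∧
      ∀ i j, j ≤ i → recombine Qᵀ b i * recombine P a j = 0 := by
  have := finiteDimensional_spaceL a
  have := finiteDimensional_spaceV a b
  have htri : ∀ ζ, Module.finrank ℂ (orbit (spaceL a) ζ) = lDim (spaceL a) →
      Module.finrank ℂ (orbit (spaceV a b) ζ) = lDim (spaceV a b) →
      ∃ P Q : Matrix (Fin n) (Fin n) ℂ, P * Q = 1 ∧ Q * P = 1 ∧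
        ∀ B ∈ LinearMap.range (localMatrix a b ζ), Q * B * P ∈ strictUpper ℂ n := by
    intro ζ h₁ h₂
    refine exists_conj_mem_strictUpper ?_ (by rw [finrank_range_localMatrix, h₂, hV])
    rintro _ ⟨f, rfl⟩
    exact isNilpotent_localMatrix hA hφ hnil (linearIndependent_of_finrank_orbit (h₁.trans hL)) f
  obtain ⟨ζ, h₁, h₂⟩ := exists_generic (spaceL a) (spaceV a b)
  obtain ⟨P, Q, hPQ, hQP, hup⟩ := htri ζ h₁ h₂
  refine ⟨P, Q, hPQ, hQP, ?_⟩
  set u := recombine P a with hu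
  set v := recombine Qᵀ b with hv
  have hloc : ∀ ξ f, localMatrix u v ξ f = Q * localMatrix a b ξ f * P :=
    localMatrix_recombine a b P Q
  have h₀ : ∀ f, localMatrix u v ζ f ∈ strictUpper ℂ n := fun f => by
    rw [hloc]; exact hup _ ⟨f, rfl⟩
  -- By the dimensions, every strictly upper triangular matrix occurs.
  have hrange : LinearMap.range (localMatrix u v ζ) = strictUpper ℂ n := by
    refine Submodule.eq_of_le_of_finrank_le (by rintro _ ⟨f, rfl⟩; exact h₀ f) ?_
    refine (finrank_le_choose_of_isNilpotent fun B hB =>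
      isNilpotent_of_mem_strictUpper hB).trans ?_
    rw [← hV, ← h₂, ← finrank_range_localMatrix]
    have hle : LinearMap.range (localMatrix a b ζ) ≤
        (LinearMap.range (localMatrix u v ζ)).map
          (LinearMap.mulLeft ℂ P ∘ₗ LinearMap.mulRight ℂ Q) := by
      rintro _ ⟨f, rfl⟩
      refine ⟨_, ⟨f, rfl⟩, ?_⟩
      simp only [LinearMap.comp_apply, LinearMap.mulLeft_apply, LinearMap.mulRight_apply, hloc]
      calc P * (Q * localMatrix a b ζ f * P * Q)
          = (P * Q) * localMatrix a b ζ f * (P * Q) := by simp only [mul_assoc]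
        _ = _ := by rw [hPQ, one_mul, mul_one]
    exact (Submodule.finrank_mono hle).trans (Submodule.finrank_map_le _ _)
  have key : ∀ η f, localMatrix u v η f ∈ strictUpper ℂ n := by
    intro η
    have f₁ := finite_setOf_finrank_orbit_ne (spaceL a) h₁ η
    have f₂ := finite_setOf_finrank_orbit_ne (spaceV a b) h₂ η
    refine mem_strictUpper_of_pencil (localMatrix u v ζ) (localMatrix u v η) h₀
      (fun B hB => by rw [← hrange] at hB; exact hB) (f₁.union f₂).infinite_compl ?_
    intro t ht d₁ d₂ d₃
    simp only [Set.mem_compl_iff, Set.mem_union, not_or, Set.mem_ofPred_eq, not_not] at ht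
    obtain ⟨P', Q', hPQ', hQP', hup'⟩ := htri _ ht.1 ht.2
    rw [← localMatrix_add_smul, ← localMatrix_add_smul, ← localMatrix_add_smul, hloc, hloc, hloc,
      ← conj_mul_sub hPQ, isNilpotent_conj_iff hPQ hQP, ← isNilpotent_conj_iff hPQ' hQP',
      conj_mul_sub hPQ']
    exact isNilpotent_of_mem_strictUpper (Submodule.sub_mem _
      (mul_mem_strictUpper (hup' _ ⟨d₁, rfl⟩) (hup' _ ⟨d₂, rfl⟩)) (hup' _ ⟨d₃, rfl⟩))
  intro i j hji
  ext η
  exact (Module.forall_dual_apply_eq_zero_iff ℂ _).1 fun f => key η f i j hji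

theorem finrank_spaceV_le {a b : Fin n → Module.End ℂ X} {P Q : Matrix (Fin n) (Fin n) ℂ}
    (hPQ : P * Q = 1) (hQP : Q * P = 1)
    (h : ∀ i j, j ≤ i → recombine Qᵀ b i * recombine P a j = 0) :
    Module.finrank ℂ (spaceV a b) ≤ n.choose 2 := by
  rw [spaceV, ← finrank_range_pairing fun i j => b i * a j]
  refine finrank_le_choose_of_isNilpotent ?_
  rintro _ ⟨g, rfl⟩
  rw [← isNilpotent_conj_iff hPQ hQP]
  refine isNilpotent_of_mem_strictUpper fun i j hji => ?_
  rw [← map_zero g, ← h i j hji]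
  simp only [recombine, Matrix.mul_apply, Matrix.transpose_apply, pairing_apply, Finset.sum_mul,
    Finset.mul_sum, map_sum, smul_mul_assoc, mul_smul_comm, map_smul, smul_eq_mul]
  exact Finset.sum_congr rfl fun k _ => Finset.sum_congr rfl fun l _ => by ring

end ElementaryOperator

end ElemOp

theorem theorem3p3 {X : Type*} [AddCommGroup X] [Module ℂ X]
    (A : NonUnitalSubalgebra ℂ (Module.End ℂ X)) (hA : ElemOp.IsDenseAlgebra A)
    (n : ℕ) (φ : A →ₗ[ℂ] Module.End ℂ X) (hlen : ElemOp.HasLength φ n)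
    (a b : Fin n → Module.End ℂ X) (hφ : ElemOp.IsRepresentation φ a b)
    (hL : ElemOp.lDim (ElemOp.spaceL a) = n)
    (hnil : ElemOp.LocallyNilpotentCond φ a b) :
    ElemOp.lDim (ElemOp.spaceV a b) ≤ n * (n - 1) / 2 ∧
      (ElemOp.lDim (ElemOp.spaceV a b) = n * (n - 1) / 2 →
        (∃ u v : Fin n → Module.End ℂ X, ElemOp.IsRepresentation φ u v ∧
          ∀ i j : Fin n, j ≤ i → v i * u j = 0) ∧
        Module.finrank ℂ (ElemOp.spaceV a b) = n * (n - 1) / 2) := by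
  rw [← Nat.choose_two_right]
  refine ⟨ElemOp.lDim_spaceV_le hA hφ hL hnil, fun hV => ?_⟩
  obtain ⟨P, Q, hPQ, hQP, h⟩ := ElemOp.exists_recombine_mul_eq_zero hA hφ hL hnil hV
  have := ElemOp.finiteDimensional_spaceV a b
  exact ⟨⟨_, _, ElemOp.isRepresentation_recombine hφ hPQ, h⟩,
    (ElemOp.finrank_spaceV_le hPQ hQP h).antisymm (hV ▸ ElemOp.lDim_le_finrank _)⟩
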